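/- Let $f,g\in\mathbb{C}[x]$ with $m=\deg f$, $n=\deg g$ and $m<n<2m+1$; write $f=f_0x^m+\ldots+f_m$, $g=g_0x^n+\ldots+g_n$, $f_0g_0\neq0$, and put $g_j=0$ for $j<0$. An invariant algebraic curve of the Liénard system $x_t=y$, $y_t=-f(x)y-g(x)$ is a polynomial $F\in\mathbb{C}[x,y]\setminus\mathbb{C}$ such that $yF_x-(f(x)y+g(x))F_y=\lambda F$ for some $\lambda\in\mathbb{C}[x,y]$. The series of type (II) is the Laurent series near $x=\infty$ of the form $y_{II}(x)=-\frac{g_0}{f_0}x^{n-m}+(\text{lower powers of }x)$ that satisfies $yy_x+f(x)y+g(x)=0$; $F$ captures it if $F(x,y_{II}(x))=0$. Let $q(x)=\sum_{l=0}^{m}q_lx^{m+1-l}$, where $q_0=-\frac{f_0}{m+1}$ and, for $1\le l\le m$, $$q_l=\frac{m+1}{(m-l+1)f_0}\left\{\sum_{k=0}^{l-1}q_kf_{l-k}+\sum_{k=1}^{l-1}(m+1-k)q_kq_{l-k}+g_{n+l-(2m+1)}\right\}.$$ If $F\in\mathbb{C}[x,y]$ is an irreducible invariant algebraic curve of this system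 that does not capture the series of type (II), then $F$ is of degree one in $y$; moreover, up to a nonzero constant factor, $F(x,y)=y-q(x)-z_0$ for some $z_0\in\mathbb{C}$. -/

import Mathlib

open Polynomial

noncomputable section

namespace Lienard

/-! Polynomials in `ℂ[x, y]` are represented as elements of `ℂ[X][X]`: the inner variable
is `x`, the outer variable is `y`. -/

/-- The partial derivative `F_x`. -/
def dx (F : ℂ[X][X]) : ℂ[X][X] := F.sum fun i a => monomial i (derivative a)

/-- The partial derivative `F_y`. -/
def dy (F : ℂ[X][X]) : ℂ[X][X] := derivative F

/-- `F` is an invariant algebraic curve of `x_t = P(x, y)`, `y_t = Q(x, y)`: it is a nonconstant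
polynomial such that `P F_x + Q F_y = lam F` for some polynomial cofactor `lam`. -/
def IsInvariantCurve (P Q F : ℂ[X][X]) : Prop :=
  (∀ c : ℂ, F ≠ C (C c)) ∧ ∃ lam : ℂ[X][X], P * dx F + Q * dy F = lam * F

/-- Invariant algebraic curves of the Liénard system `x_t = y`, `y_t = -f(x) y - g(x)`. -/
def IsLienardCurve (f g : ℂ[X]) (F : ℂ[X][X]) : Prop :=
  IsInvariantCurve X (-(C f * X) - C g) F

/-! Laurent series near `x = ∞` are elements of `LaurentSeries ℂ` in the variable `t = 1/x`:
the coefficient of `x ^ (-k)` is `coeff k`. -/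

/-- The function `x`, as a Laurent series near `x = ∞`. -/
def xInf : LaurentSeries ℂ := HahnSeries.single (-1 : ℤ) (1 : ℂ)

/-- The derivative with respect to `x` of a Laurent series near `x = ∞`:
`d/dx = -t ^ 2 d/dt` for `t = 1/x`. -/
def ddx (y : LaurentSeries ℂ) : LaurentSeries ℂ :=
  -(HahnSeries.single (2 : ℤ) (1 : ℂ) * LaurentSeries.derivative ℂ y)

/-- The series `y(x)` satisfies `y y_x + f(x) y + g(x) = 0`. -/
def SolvesODE (f g : ℂ[X]) (y : LaurentSeries ℂ) : Prop :=
  y * ddx y + aeval xInf f * y + aeval xInf g = 0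

/-- The series of type (II), with `m = deg f` and `n = deg g`: a solution near `x = ∞` of
`y y_x + f(x) y + g(x) = 0` of the form `y(x) = -(g₀ / f₀) x ^ (n - m) + (lower powers of x)`,
where `f₀`, `g₀` are the leading coefficients of `f`, `g`. -/
def IsTypeII (f g : ℂ[X]) (y : LaurentSeries ℂ) : Prop :=
  SolvesODE f g y ∧
    y.coeff ((f.natDegree : ℤ) - (g.natDegree : ℤ)) = -(g.leadingCoeff / f.leadingCoeff) ∧
    ∀ k : ℤ, k < (f.natDegree : ℤ) - (g.natDegree : ℤ) → y.coeff k = 0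

/-- The curve `F` captures the series `y(x)`: `F(x, y(x)) = 0`. -/
def Captures (F : ℂ[X][X]) (y : LaurentSeries ℂ) : Prop :=
  aevalAeval xInf y F = 0

/-- The coefficients `q_l`, `0 ≤ l ≤ m = deg f`: `q_0 = -f₀ / (m + 1)` and, for `1 ≤ l ≤ m`,
`q_l = (m + 1) / ((m - l + 1) f₀) * (∑_{k=0}^{l-1} q_k f_{l-k}
  + ∑_{k=1}^{l-1} (m + 1 - k) q_k q_{l-k} + g_{n+l-(2m+1)})`,
where `f_j`, `g_j` are the coefficients of `f`, `g` at `x ^ (m - j)`, `x ^ (n - j)`; thus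
`g_{n+l-(2m+1)}` is the coefficient of `g` at `x ^ (2m+1-l)`, which is zero if `2m+1-l > n`. -/
def qCoeff (f g : ℂ[X]) : ℕ → ℂ
  | 0 => -(f.leadingCoeff / ((f.natDegree : ℂ) + 1))
  | l + 1 =>
    ((f.natDegree : ℂ) + 1) / (((f.natDegree : ℂ) - ((l + 1 : ℕ) : ℂ) + 1) * f.leadingCoeff) *
      ((∑ k : Fin (l + 1), qCoeff f g k * f.coeff (f.natDegree - (l + 1 - (k : ℕ))))
        + (∑ k : Fin l, ((f.natDegree : ℂ) + 1 - (((k : ℕ) + 1 : ℕ) : ℂ)) *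
            qCoeff f g ((k : ℕ) + 1) * qCoeff f g (l - (k : ℕ)))
        + g.coeff (2 * f.natDegree + 1 - (l + 1)))
  termination_by l => l
  decreasing_by all_goals omega

/-- The polynomial `q(x) = ∑_{l=0}^{m} q_l x ^ (m + 1 - l)`, the part with positive powers of `x`
of the series of type (I). -/
def q (f g : ℂ[X]) : ℂ[X] :=
  ∑ l ∈ Finset.range (f.natDegree + 1), C (qCoeff f g l) * X ^ (f.natDegree + 1 - l)

end Lienard

end

noncomputable section

namespace Lienard

/-! A type (II) series `y` exists, and by hypothesis `z = F(x, y(x))` is nonzero. The chain rule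
gives `y * z_x = lam * z`. Since the cofactor is a polynomial `l(x)`, comparing orders at infinity
yields `deg l ≤ n - m - 1 < m` (`natDegree_cofactor_lt`). Put `y = q + w` and `G(x, w) = F(x, w +
q)`. The recursion for `q` makes `deg (q' + f) < m` and `deg (q q' + f q + g) ≤ m`, while `deg q = m
+ 1`. In the equation for `G` the term `q G_x` then dominates: a slope argument on the degrees in
`x` of the coefficients of the powers of `w` shows that all of them are constants
(`natDegree_coeff_eq_zero`). So `G` is an irreducible polynomial in `w` alone over `ℂ`, hence
linear. -/

/-! ### Differential calculus of Laurent series at infinity. -/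

theorem algebraMap_laurentSeries (a : ℂ) :
    algebraMap ℂ (LaurentSeries ℂ) a = HahnSeries.single 0 a :=
  LaurentSeries.algebraMap_apply ℂ a

theorem ddx_coeff (y : LaurentSeries ℂ) (k : ℤ) :
    (ddx y).coeff k = -(((k - 1 : ℤ) : ℂ) * y.coeff (k - 1)) := by
  have h : k - 2 + 1 = k - 1 := by ring
  rw [ddx, HahnSeries.coeff_neg, HahnSeries.coeff_single_mul]
  simp [h]

theorem ddx_add (y z : LaurentSeries ℂ) : ddx (y + z) = ddx y + ddx z := by
  ext k
  simp only [ddx_coeff, HahnSeries.coeff_add]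
  ring

theorem ddx_single (k : ℤ) (c : ℂ) :
    ddx (HahnSeries.single k c) = HahnSeries.single (k + 1) (-(k * c)) := by
  ext j
  rw [ddx_coeff]
  by_cases h : j = k + 1
  · subst h
    simp
  · rw [HahnSeries.coeff_single_of_ne h, HahnSeries.coeff_single_of_ne (by grind)]
    simp

/-- The Euler operator `t d/dt`. -/
def euler (y : LaurentSeries ℂ) : LaurentSeries ℂ :=
  HahnSeries.single (1 : ℤ) (1 : ℂ) * LaurentSeries.derivative ℂ y

theorem euler_coeff (y : LaurentSeries ℂ) (k : ℤ) : (euler y).coeff k = k * y.coeff k := by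
  rw [euler, HahnSeries.coeff_single_mul]
  simp

theorem ddx_eq_euler (y : LaurentSeries ℂ) :
    ddx y = -(HahnSeries.single (1 : ℤ) (1 : ℂ) * euler y) := by
  rw [ddx, euler, ← mul_assoc, HahnSeries.single_mul_single]
  norm_num

/-- The Euler operator is diagonal and does not enlarge supports, so all three products are sums
over one antidiagonal, where the identity is `k = i + j`. The Leibniz rule for `ddx` is deduced from
this one. -/
theorem euler_mul (y z : LaurentSeries ℂ) : euler (y * z) = euler y * z + y * euler z := by
  have hs : ∀ w : LaurentSeries ℂ, (euler w).support ⊆ w.support := by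
    intro w k hk hw
    exact hk (by simp [euler_coeff, hw])
  ext k
  rw [euler_coeff, HahnSeries.coeff_add, HahnSeries.coeff_mul,
    HahnSeries.coeff_mul_left' y.isPWO_support (hs y),
    HahnSeries.coeff_mul_right' z.isPWO_support (hs z), Finset.mul_sum, ← Finset.sum_add_distrib]
  refine Finset.sum_congr rfl fun ij hij => ?_
  have h := (Finset.mem_antidiagonal.1 hij).2.2
  rw [euler_coeff, euler_coeff, ← h]
  push_cast
  ring

theorem ddx_mul (y z : LaurentSeries ℂ) : ddx (y * z) = ddx y * z + y * ddx z := by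
  simp only [ddx_eq_euler, euler_mul]
  ring

theorem euler_ofPowerSeries (u : PowerSeries ℂ) :
    euler (HahnSeries.ofPowerSeries ℤ ℂ u) =
      HahnSeries.ofPowerSeries ℤ ℂ (PowerSeries.X * PowerSeries.derivative ℂ u) := by
  ext k
  rw [euler_coeff, PowerSeries.coeff_coe, PowerSeries.coeff_coe]
  split_ifs with h
  · simp
  · obtain ⟨n, rfl⟩ := Int.eq_ofNat_of_zero_le (not_lt.1 h)
    cases n with
    | zero => simp
    | succ n =>
      rw [show ((n + 1 : ℕ) : ℤ).natAbs = n + 1 from rfl, PowerSeries.coeff_succ_X_mul,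
        PowerSeries.coeff_derivative]
      push_cast
      ring

theorem aeval_xInf_eq_reverse (p : ℂ[X]) :
    aeval xInf p = HahnSeries.single (-(p.natDegree : ℤ)) (1 : ℂ) *
      HahnSeries.ofPowerSeries ℤ ℂ (p.reverse : PowerSeries ℂ) := by
  have h1 : HahnSeries.single (1 : ℤ) (1 : ℂ) * xInf = 1 := by
    rw [xInf, HahnSeries.single_mul_single]; simp
  let _ : Invertible xInf := ⟨HahnSeries.single (1 : ℤ) (1 : ℂ), h1, by rw [mul_comm]; exact h1⟩
  have h := eval₂_reverse_mul_pow (algebraMap ℂ (LaurentSeries ℂ)) xInf p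
  have h2 : HahnSeries.ofPowerSeries ℤ ℂ (p.reverse : PowerSeries ℂ) =
      eval₂ (algebraMap ℂ (LaurentSeries ℂ)) (⅟xInf) p.reverse := by
    have : ∀ r : ℂ[X], HahnSeries.ofPowerSeries ℤ ℂ (r : PowerSeries ℂ) =
      eval₂ (algebraMap ℂ (LaurentSeries ℂ)) (HahnSeries.single (1 : ℤ) (1 : ℂ)) r := by
      intro r
      induction r using Polynomial.induction_on' with
      | add a b ha hb => rw [Polynomial.coe_add, map_add, ha, hb, eval₂_add]
      | monomial n a =>
        rw [eval₂_monomial, ← C_mul_X_pow_eq_monomial]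
        simp [algebraMap_laurentSeries]
    exact this _
  rw [aeval_def, ← h, ← h2, mul_comm]
  congr 1
  rw [xInf, HahnSeries.single_pow]
  simp

theorem ddx_aeval_xInf (p : ℂ[X]) : ddx (aeval xInf p) = aeval xInf (derivative p) := by
  induction p using Polynomial.induction_on' with
  | add a b ha hb => simp only [map_add, ddx_add, ha, hb]
  | monomial n a =>
    rw [derivative_monomial, aeval_monomial, aeval_monomial, xInf, HahnSeries.single_pow,
      HahnSeries.single_pow, algebraMap_laurentSeries, algebraMap_laurentSeries, HahnSeries.single_mul_single,
      HahnSeries.single_mul_single, ddx_single]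
    cases n with
    | zero => simp
    | succ n =>
      congr 1
      · simp
      · simp; ring

/-! ### Existence of the type (II) series. -/

/-- A map on power series that gains one order of contact has a fixed point. -/
theorem exists_fixedPoint_powerSeries {R : Type*} [Semiring R] (T : PowerSeries R → PowerSeries R)
    (hT : ∀ (n : ℕ) (u v : PowerSeries R),
      (∀ k < n, PowerSeries.coeff k u = PowerSeries.coeff k v) →
      ∀ k < n + 1, PowerSeries.coeff k (T u) = PowerSeries.coeff k (T v)) :
    ∃ u, T u = u := by
  have key : ∀ n : ℕ, ∀ k < n, PowerSeries.coeff k (T^[n] 0) = PowerSeries.coeff k (T^[n + 1] 0) := by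
    intro n
    induction n with
    | zero => simp
    | succ n ih =>
      rw [Function.iterate_succ_apply', Function.iterate_succ_apply' T (n + 1)]
      exact hT n _ _ ih
  have key2 : ∀ n m k : ℕ, k < n →
      PowerSeries.coeff k (T^[n] 0) = PowerSeries.coeff k (T^[n + m] 0) := by
    intro n m k hk
    induction m with
    | zero => rfl
    | succ m ih => rw [ih]; exact key (n + m) k (by omega)
  -- The coefficient of index `n` is stationary from the iterate `n + 1` on; `u` collects the
  -- limits.
  set u : PowerSeries R := PowerSeries.mk fun n => PowerSeries.coeff n (T^[n + 1] 0) with hu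
  have hu' : ∀ n, ∀ k < n, PowerSeries.coeff k u = PowerSeries.coeff k (T^[n] 0) := by
    intro n k hk
    obtain ⟨m, rfl⟩ := Nat.exists_eq_add_of_lt hk
    rw [hu, PowerSeries.coeff_mk, key2 (k + 1) m k (by omega)]
    congr 2
    omega
  refine ⟨u, PowerSeries.ext fun n => ?_⟩
  rw [hT n u _ (hu' n) n (by omega), ← Function.iterate_succ_apply' T, hu' (n + 1) n (by omega)]

/-- With `t = 1/x` and `y = t^(m-n) u`, the equation becomes `a u + b + t^(2m+1-n) D u = 0`, where
`a`, `b` are the reversed `f`, `g`. As `a` is invertible and `2m+1-n > 0`, solving for the `u` in `a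
u` gives a contracting map. -/
theorem exists_isTypeII (f g : ℂ[X]) (hfg : f.natDegree < g.natDegree)
    (hgf : g.natDegree < 2 * f.natDegree + 1) : ∃ y, IsTypeII f g y := by
  obtain ⟨d, hd⟩ := Nat.exists_eq_add_of_lt hfg
  obtain ⟨e, he⟩ := Nat.exists_eq_add_of_lt hgf
  have hf0 : f.leadingCoeff ≠ 0 := by
    rw [Ne, leadingCoeff_eq_zero]
    rintro rfl
    simp at hgf
    omega
  set a : PowerSeries ℂ := (f.reverse : PowerSeries ℂ) with ha
  set b : PowerSeries ℂ := (g.reverse : PowerSeries ℂ) with hb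
  have ha0 : PowerSeries.constantCoeff a = f.leadingCoeff := by
    rw [ha, ← PowerSeries.coeff_zero_eq_constantCoeff_apply, Polynomial.coeff_coe,
      coeff_zero_reverse]
  have hb0 : PowerSeries.constantCoeff b = g.leadingCoeff := by
    rw [hb, ← PowerSeries.coeff_zero_eq_constantCoeff_apply, Polynomial.coeff_coe,
      coeff_zero_reverse]
  have haa : a * a⁻¹ = 1 := PowerSeries.mul_inv_cancel a (by rwa [ha0])
  -- Here `c = n - m`, and `e + 1 = 2m + 1 - n`.
  obtain ⟨c, hc⟩ : ∃ c : ℂ, c = (d : ℂ) + 1 := ⟨_, rfl⟩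
  set D : PowerSeries ℂ → PowerSeries ℂ := fun u =>
    PowerSeries.C c * u ^ 2 - PowerSeries.X * PowerSeries.derivative ℂ u * u with hD
  obtain ⟨u, hu⟩ := exists_fixedPoint_powerSeries
    (fun u => -(a⁻¹ * (b + PowerSeries.X ^ (e + 1) * D u))) (by
      intro n u v huv
      have hX : (PowerSeries.X : PowerSeries ℂ) ^ n ∣ u - v := by
        rw [PowerSeries.X_pow_dvd_iff]
        intro k hk
        rw [map_sub, huv k hk, sub_self]
      obtain ⟨w, hw⟩ := hX
      have hdw : PowerSeries.X * PowerSeries.derivative ℂ (u - v) =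
          PowerSeries.X ^ n * ((n : PowerSeries ℂ) * w + PowerSeries.X * PowerSeries.derivative ℂ w) := by
        rw [hw, Derivation.leibniz, Derivation.leibniz_pow, PowerSeries.derivative_X]
        cases n with
        | zero => simp
        | succ n => simp only [smul_eq_mul, nsmul_eq_mul]; push_cast; simp; ring
      have hdu : u = v + PowerSeries.X ^ n * w := by rw [← hw]; ring
      have hdd : PowerSeries.X * PowerSeries.derivative ℂ u =
          PowerSeries.X * PowerSeries.derivative ℂ v +
          PowerSeries.X ^ n * ((n : PowerSeries ℂ) * w + PowerSeries.X * PowerSeries.derivative ℂ w) := by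
        rw [← hdw, map_sub]; ring
      have : (PowerSeries.X : PowerSeries ℂ) ^ (n + 1) ∣
          -(a⁻¹ * (b + PowerSeries.X ^ (e + 1) * D u)) -
          -(a⁻¹ * (b + PowerSeries.X ^ (e + 1) * D v)) := by
        simp only [hD, hdd]
        generalize PowerSeries.X * PowerSeries.derivative ℂ v = v'
        generalize (n : PowerSeries ℂ) * w + PowerSeries.X * PowerSeries.derivative ℂ w = w'
        rw [hdu]
        refine ⟨-a⁻¹ * PowerSeries.X ^ e * (PowerSeries.C c *
          (2 * v * w + PowerSeries.X ^ n * w ^ 2) -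
          (v' * w + w' * v + PowerSeries.X ^ n * w' * w)), ?_⟩
        ring
      rw [PowerSeries.X_pow_dvd_iff] at this
      intro k hk
      exact sub_eq_zero.1 (by rw [← map_sub]; exact this k hk))
  have hau : a * u + b + PowerSeries.X ^ (e + 1) * D u = 0 := by
    have : a * u = -((a * a⁻¹) * (b + PowerSeries.X ^ (e + 1) * D u)) := by
      conv_lhs => rw [← hu]
      ring
    rw [this, haa]; ring
  have hu0 : PowerSeries.constantCoeff u = -(g.leadingCoeff / f.leadingCoeff) := by
    have := congrArg PowerSeries.constantCoeff hau
    simp only [map_add, map_mul, ha0, hb0, map_pow, PowerSeries.constantCoeff_X] at this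
    field_simp
    simp at this
    linear_combination this
  refine ⟨HahnSeries.single (-((d : ℤ) + 1)) (1 : ℂ) * HahnSeries.ofPowerSeries ℤ ℂ u, ?_, ?_, ?_⟩
  · have hX : HahnSeries.single ((e : ℤ) + 1) (1 : ℂ) =
        HahnSeries.ofPowerSeries ℤ ℂ (PowerSeries.X ^ (e + 1)) := by
      rw [HahnSeries.ofPowerSeries_X_pow]; push_cast; rfl
    have hE := congrArg (HahnSeries.ofPowerSeries ℤ ℂ) hau
    simp only [map_add, map_mul, hD, map_sub, map_zero, ← hX, HahnSeries.ofPowerSeries_C,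
      map_pow (HahnSeries.ofPowerSeries ℤ ℂ) u] at hE
    rw [← map_mul (HahnSeries.ofPowerSeries ℤ ℂ) PowerSeries.X, ← euler_ofPowerSeries] at hE
    have heul : euler (HahnSeries.single (-((d : ℤ) + 1)) (1 : ℂ)) =
        -(HahnSeries.C c) * HahnSeries.single (-((d : ℤ) + 1)) (1 : ℂ) := by
      ext k
      rw [euler_coeff, ← map_neg, HahnSeries.C_mul_eq_smul, HahnSeries.coeff_smul, hc]
      by_cases hk : k = -((d : ℤ) + 1)
      · subst hk; push_cast; simp
      · rw [HahnSeries.coeff_single_of_ne hk]; simp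
    rw [SolvesODE, ddx_eq_euler, euler_mul, heul, aeval_xInf_eq_reverse f,
      aeval_xInf_eq_reverse g]
    have hs1 : HahnSeries.single (-(f.natDegree : ℤ)) (1 : ℂ) *
        HahnSeries.single (-((d : ℤ) + 1)) (1 : ℂ) =
        HahnSeries.single (-(g.natDegree : ℤ)) (1 : ℂ) := by
      rw [HahnSeries.single_mul_single]
      rw [hd, mul_one]
      congr 2
      push_cast
      ring
    have hs2 : HahnSeries.single (-((d : ℤ) + 1)) (1 : ℂ) *
        HahnSeries.single (-((d : ℤ) + 1)) (1 : ℂ) * HahnSeries.single (1 : ℤ) (1 : ℂ) =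
        HahnSeries.single (-(g.natDegree : ℤ)) (1 : ℂ) *
        HahnSeries.single ((e : ℤ) + 1) (1 : ℂ) := by
      rw [HahnSeries.single_mul_single, HahnSeries.single_mul_single,
        HahnSeries.single_mul_single]
      rw [mul_one, mul_one, show -((d : ℤ) + 1) + -((d : ℤ) + 1) + 1 =
        -(g.natDegree : ℤ) + ((e : ℤ) + 1) by omega]
    generalize HahnSeries.ofPowerSeries ℤ ℂ u = U at *
    generalize euler U = U' at *
    rw [← ha, ← hb]
    linear_combination HahnSeries.single (-(g.natDegree : ℤ)) (1 : ℂ) * hE +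
      (HahnSeries.ofPowerSeries ℤ ℂ a * U) * hs1 +
      (HahnSeries.C c * U ^ 2 - U' * U) * hs2
  · rw [HahnSeries.coeff_single_mul, PowerSeries.coeff_coe,
      show (f.natDegree : ℤ) - g.natDegree - -((d : ℤ) + 1) = 0 by omega]
    simpa using hu0
  · intro k hk
    rw [HahnSeries.coeff_single_mul, PowerSeries.coeff_coe, if_pos (by omega), mul_zero]

/-! ### Partial derivatives, the chain rule and the cofactor. -/

theorem dx_coeff (F : ℂ[X][X]) (i : ℕ) : (dx F).coeff i = derivative (F.coeff i) := by
  rw [dx, Polynomial.sum, finsetSum_coeff]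
  simp only [coeff_monomial]
  rw [Finset.sum_ite_eq' F.support i]
  split_ifs with h
  · rfl
  · rw [notMem_support_iff.1 h, derivative_zero]

theorem dx_add (F G : ℂ[X][X]) : dx (F + G) = dx F + dx G := by
  ext1 i
  simp only [dx_coeff, coeff_add, derivative_add]

theorem dx_mul (F G : ℂ[X][X]) : dx (F * G) = dx F * G + F * dx G := by
  ext1 i
  simp only [dx_coeff, coeff_mul, coeff_add, derivative_sum, derivative_mul,
    Finset.sum_add_distrib]

theorem dx_C (a : ℂ[X]) : dx (C a) = C (derivative a) := by
  ext1 i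
  rw [dx_coeff, coeff_C, coeff_C]
  split_ifs <;> simp

theorem dx_X : dx X = 0 := by
  ext1 i
  rw [dx_coeff, coeff_X]
  split_ifs <;> simp

/-- The chain rule: a map `D` satisfying the Leibniz rule, and compatible with `d/dx` along `φ`. -/
theorem chain_rule {S : Type*} [CommRing S] (φ : ℂ[X][X] →+* S) (D : S → S)
    (hadd : ∀ a b, D (a + b) = D a + D b) (hmul : ∀ a b, D (a * b) = D a * b + a * D b)
    (hC : ∀ a, D (φ (C a)) = φ (C (derivative a))) (F : ℂ[X][X]) :
    D (φ F) = φ (dx F) + φ (dy F) * D (φ X) := by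
  induction F using Polynomial.induction_on with
  | C a => rw [hC, dx_C, dy, derivative_C, map_zero, zero_mul, add_zero]
  | add F G hF hG =>
    rw [map_add, hadd, hF, hG, dx_add, dy, dy, dy, derivative_add, map_add, map_add]
    ring
  | monomial n a h =>
    rw [pow_succ, ← mul_assoc, map_mul, hmul, h, dx_mul (C a * X ^ n) X, dx_X, dy, dy,
      derivative_mul (f := C a * X ^ n), derivative_X]
    simp only [map_add, map_mul, mul_zero, mul_one, add_zero]
    ring

/-- The cofactor of an invariant curve does not depend on `y`, and the coefficient of the highest
power of `y` is constant. -/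
theorem cofactor_eq_C {f g : ℂ[X]} {F lam : ℂ[X][X]} (hF : F ≠ 0)
    (h : X * dx F + (-(C f * X) - C g) * dy F = lam * F) :
    (∃ l, lam = C l) ∧ ∃ c : ℂ, F.leadingCoeff = C c := by
  have hdx : (dx F).natDegree ≤ F.natDegree := by
    rw [natDegree_le_iff_coeff_eq_zero]
    intro i hi
    rw [dx_coeff, coeff_eq_zero_of_natDegree_lt hi, derivative_zero]
  have hdy : (dy F).natDegree ≤ F.natDegree :=
    (natDegree_derivative_le F).trans (Nat.sub_le _ _)
  have hP : (-(C f * X) - C g : ℂ[X][X]).natDegree ≤ 1 := by compute_degree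
  have hlam : lam.natDegree ≤ 1 := by
    by_cases h0 : lam = 0
    · simp [h0]
    have h1 : (lam * F).natDegree ≤ 1 + F.natDegree := by
      rw [← h]
      exact natDegree_add_le_of_degree_le (natDegree_mul_le_of_le natDegree_X_le hdx)
        (natDegree_mul_le_of_le hP hdy)
    rw [natDegree_mul h0 hF] at h1
    omega
  -- The top power of `y` gives `F_N' = lam_1 * F_N` for the leading coefficient `F_N`;
  -- differentiation lowers the degree, so `lam_1 = 0`.
  have hc := congrArg (fun p => coeff p (1 + F.natDegree)) h
  simp only [coeff_add] at hc
  rw [coeff_mul_add_eq_of_natDegree_le natDegree_X_le hdx, coeff_mul_add_eq_of_natDegree_le hP hdy,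
    coeff_mul_add_eq_of_natDegree_le hlam le_rfl, dy, coeff_derivative, coeff_eq_zero_of_natDegree_lt
      (Nat.lt_succ_self F.natDegree), dx_coeff, coeff_X_one, zero_mul, mul_zero, add_zero,
    one_mul, coeff_natDegree] at hc
  have hlc : F.leadingCoeff ≠ 0 := leadingCoeff_ne_zero.2 hF
  have hl1 : lam.coeff 1 = 0 := by
    by_contra hne
    have := degree_derivative_lt hlc
    rw [hc, degree_mul] at this
    exact absurd this (not_lt.2 (le_add_of_nonneg_left (zero_le_degree_iff.2 hne)))
  rw [hl1, zero_mul] at hc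
  refine ⟨⟨lam.coeff 0, eq_C_of_natDegree_le_zero ?_⟩, F.leadingCoeff.coeff 0,
    eq_C_of_derivative_eq_zero hc⟩
  rw [natDegree_le_iff_coeff_eq_zero]
  intro i hi
  rcases Nat.lt_or_ge 1 i with h1 | h1
  · exact coeff_eq_zero_of_natDegree_lt (by omega)
  · rw [show i = 1 by omega, hl1]

theorem natDegree_cofactor_lt {f g l : ℂ[X]} {F : ℂ[X][X]} {y : LaurentSeries ℂ}
    (hfg : f.natDegree < g.natDegree) (hgf : g.natDegree < 2 * f.natDegree + 1)
    (h : X * dx F + (-(C f * X) - C g) * dy F = C l * F)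
    (hy : IsTypeII f g y) (hyF : ¬ Captures F y) : l.natDegree < f.natDegree := by
  by_cases hl : l = 0
  · rw [hl, natDegree_zero]; omega
  obtain ⟨hode, -, hlow⟩ := hy
  set z := aevalAeval xInf y F with hz
  have hz0 : z ≠ 0 := hyF
  have hchain := chain_rule (aevalAeval xInf y : ℂ[X][X] →ₐ[ℂ] LaurentSeries ℂ).toRingHom ddx
    ddx_add ddx_mul (fun a => by simp [ddx_aeval_xInf]) F
  simp only [AlgHom.toRingHom_eq_coe, RingHom.coe_coe, aevalAeval_Y] at hchain
  rw [← hz] at hchain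
  have hF := congrArg (aevalAeval xInf y) h
  simp only [map_add, map_mul, map_sub, map_neg, aevalAeval_Y, aevalAeval_C] at hF
  rw [← hz] at hF
  have hyz : y * ddx z = aeval xInf l * z := by
    rw [hchain, ← hF]
    rw [SolvesODE] at hode
    linear_combination (aevalAeval xInf y (dy F)) * hode
  have hlc : (aeval xInf l).coeff (-(l.natDegree : ℤ)) = l.leadingCoeff := by
    rw [aeval_xInf_eq_reverse, HahnSeries.coeff_single_mul, sub_self, PowerSeries.coeff_coe]
    simp
  have hlc0 : (aeval xInf l).coeff (-(l.natDegree : ℤ)) ≠ 0 := by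
    rw [hlc]; exact leadingCoeff_ne_zero.2 hl
  have hlo := HahnSeries.order_le_of_coeff_ne_zero hlc0
  have hl0 : aeval xInf l ≠ 0 := by
    intro h0; rw [h0] at hlc0; exact hlc0 rfl
  have hne : y * ddx z ≠ 0 := by rw [hyz]; exact mul_ne_zero hl0 hz0
  have ho := congrArg HahnSeries.order hyz
  rw [HahnSeries.order_mul (left_ne_zero_of_mul hne) (right_ne_zero_of_mul hne),
    HahnSeries.order_mul hl0 hz0] at ho
  -- In the variable `t`, `y` has order at least `m - n` and `d/dx` raises the order by at least
  -- one.
  have hyo : (f.natDegree : ℤ) - g.natDegree ≤ y.order :=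
    (HahnSeries.le_order_iff_forall (left_ne_zero_of_mul hne)).2 hlow
  have hzo : z.order + 1 ≤ (ddx z).order :=
    (HahnSeries.le_order_iff_forall (right_ne_zero_of_mul hne)).2 fun k hk => by
      rw [ddx_coeff, HahnSeries.coeff_eq_zero_of_lt_order (by omega), mul_zero, neg_zero]
  omega

/-! ### Degrees in `x` of the coefficients of the shifted curve. -/

theorem natDegree_mul_derivative_le {p b : ℂ[X]} {m : ℕ} (hp : p.natDegree ≤ m + 1) :
    (p * derivative b).natDegree ≤ m + b.natDegree := by
  by_cases hb : b.natDegree = 0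
  · rw [derivative_of_natDegree_zero hb, mul_zero, natDegree_zero]; omega
  · refine (natDegree_mul_le_of_le hp (natDegree_derivative_le b)).trans ?_
    omega

theorem natDegree_le_of_derivative {b : ℂ[X]} {k : ℕ} (h : (derivative b).natDegree ≤ k) :
    b.natDegree ≤ k + 1 := by
  rw [natDegree_derivative] at h
  omega

/-- The equation satisfied by the coefficients of an invariant curve after the shift
`y = q(x) + w`. -/
theorem coeff_equation {p r s l : ℂ[X]} {G : ℂ[X][X]}
    (h : (X + C p) * dx G - (C s * X + C r) * dy G = C l * G) (k : ℕ) :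
    (X * dx G).coeff k = (l + (k : ℂ[X]) * s) * G.coeff k +
      ((k : ℂ[X]) + 1) * r * G.coeff (k + 1) - p * derivative (G.coeff k) := by
  have hk := congrArg (fun p => coeff p k) h
  have hX : (X * dy G).coeff k = (k : ℂ[X]) * G.coeff k := by
    cases k with
    | zero => simp
    | succ k => rw [coeff_X_mul, dy, coeff_derivative]; push_cast; ring
  simp only [add_mul, coeff_sub, coeff_add, coeff_C_mul, mul_assoc (C s), hX, dx_coeff] at hk
  rw [dy, coeff_derivative] at hk
  linear_combination hk

/-- `coeff_equation` expresses the derivative of one coefficient through the two above it, so each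
step down in `w` costs at most `m + 1` in degree. The first step costs at most `m`, and this makes
the bound strict throughout. -/
theorem natDegree_coeff_lt {m : ℕ} {p r s l : ℂ[X]} (hp : p.natDegree ≤ m + 1)
    (hr : r.natDegree ≤ m) (hs : s.natDegree < m) (hl : l.natDegree < m) {G : ℂ[X][X]}
    (hG : G.leadingCoeff.natDegree = 0)
    (h : (X + C p) * dx G - (C s * X + C r) * dy G = C l * G) (j : ℕ) :
    ∀ k, k + (j + 1) = G.natDegree → (G.coeff k).natDegree < (j + 1) * (m + 1) := by
  induction j using Nat.strong_induction_on with
  | _ j ih =>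
    intro k hk
    have hnat : ∀ c : ℕ, (c : ℂ[X]).natDegree ≤ 0 := fun c => (natDegree_natCast c).le
    have hle : (l + ((k + 1 : ℕ) : ℂ[X]) * s).natDegree ≤ m - 1 :=
      natDegree_add_le_of_degree_le (by omega)
        ((natDegree_mul_le_of_le (hnat _) le_rfl).trans (by omega))
    have hr' : ((((k + 1 : ℕ) : ℂ[X]) + 1) * r).natDegree ≤ m := by
      refine (natDegree_mul_le_of_le (m := 0) ?_ hr).trans (by omega)
      exact_mod_cast hnat (k + 1 + 1)
    have hq := natDegree_mul_derivative_le (b := G.coeff (k + 1)) hp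
    have he := coeff_equation h (k + 1)
    rw [coeff_X_mul, dx_coeff] at he
    have hA := natDegree_mul_le_of_le hle (le_refl (G.coeff (k + 1)).natDegree)
    have hB := natDegree_mul_le_of_le hr' (le_refl (G.coeff (k + 1 + 1)).natDegree)
    suffices hd : (derivative (G.coeff k)).natDegree ≤ (j + 1) * (m + 1) - 2 by
      have := natDegree_le_of_derivative hd
      have h2 : 1 * (m + 1) ≤ (j + 1) * (m + 1) := Nat.mul_le_mul_right _ (by omega)
      omega
    rw [he]
    rcases Nat.eq_zero_or_pos j with rfl | hj
    · have h1 : (G.coeff (k + 1)).natDegree = 0 := by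
        rw [show k + 1 = G.natDegree by omega]; exact hG
      have h2 : G.coeff (k + 1 + 1) = 0 := coeff_eq_zero_of_natDegree_lt (by omega)
      rw [h2, derivative_of_natDegree_zero h1, mul_zero, mul_zero, add_zero, sub_zero]
      omega
    · obtain ⟨j, rfl⟩ := Nat.exists_eq_succ_of_ne_zero hj.ne'
      have h1 := ih j (by omega) (k + 1) (by omega)
      have h2 : (G.coeff (k + 1 + 1)).natDegree ≤ j * (m + 1) := by
        rcases Nat.eq_zero_or_pos j with rfl | hj'
        · rw [show k + 1 + 1 = G.natDegree by omega, coeff_natDegree, hG]; simp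
        · obtain ⟨i, rfl⟩ := Nat.exists_eq_succ_of_ne_zero hj'.ne'
          exact (ih i (by omega) (k + 1 + 1) (by omega)).le
      have e1 : (j.succ + 1) * (m + 1) = j * (m + 1) + 2 * (m + 1) := by
        rw [Nat.succ_eq_add_one]; ring
      have e2 : (j + 1) * (m + 1) = j * (m + 1) + (m + 1) := by ring
      rw [e2] at h1
      exact (natDegree_sub_le _ _).trans (max_le
        (natDegree_add_le_of_degree_le (by omega) (by omega)) (by omega))

/-- A Newton polygon argument: at an index `a` maximizing the slope `deg G_k / (N - k)`, a positive
degree would leave the leading term of `p * G_a'` with nothing to cancel it. -/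
theorem natDegree_coeff_eq_zero {m : ℕ} {p r s l : ℂ[X]} (hp : p.natDegree = m + 1)
    (hr : r.natDegree ≤ m) (hs : s.natDegree < m) (hl : l.natDegree < m) {G : ℂ[X][X]}
    (hG : G.leadingCoeff.natDegree = 0)
    (h : (X + C p) * dx G - (C s * X + C r) * dy G = C l * G) (k : ℕ) :
    (G.coeff k).natDegree = 0 := by
  have htop : ∀ k, G.natDegree ≤ k → (G.coeff k).natDegree = 0 := by
    intro k hk
    rcases hk.eq_or_lt with rfl | hk
    · exact hG
    · rw [coeff_eq_zero_of_natDegree_lt hk, natDegree_zero]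
  by_contra hne
  have hkN : k < G.natDegree := by
    by_contra hk
    exact hne (htop k (by omega))
  obtain ⟨a, haN, hmax⟩ := Finset.exists_max_image (Finset.range G.natDegree)
    (fun k => ((G.coeff k).natDegree : ℚ) / ((G.natDegree - k : ℕ) : ℚ)) ⟨k, by simpa using hkN⟩
  rw [Finset.mem_range] at haN
  obtain ⟨J, hJ⟩ := Nat.exists_eq_add_of_lt haN
  have hmax' : ∀ i j, i + j + 1 = G.natDegree →
      (G.coeff i).natDegree * (J + 1) ≤ (G.coeff a).natDegree * (j + 1) := by
    intro i j hij
    have := hmax i (by simp; omega)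
    rw [show G.natDegree - i = j + 1 by omega, show G.natDegree - a = J + 1 by omega,
      div_le_div_iff₀ (by positivity) (by positivity)] at this
    exact_mod_cast this
  obtain ⟨d, hd⟩ : ∃ d, (G.coeff a).natDegree = d + 1 := by
    refine Nat.exists_eq_succ_of_ne_zero fun h0 => hne ?_
    obtain ⟨j, hj⟩ := Nat.exists_eq_add_of_lt hkN
    have := hmax' k j hj.symm
    rw [h0, zero_mul] at this
    exact (Nat.mul_eq_zero.1 (Nat.le_zero.1 this)).resolve_right (by omega)
  -- The maximal slope is strictly less than `m + 1`.
  have hsmall := natDegree_coeff_lt hp.le hr hs hl hG h J a (by omega)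
  rw [hd] at hmax' hsmall
  -- `m + 1 + d` is the exact degree of `p * G_a'`.
  have he := congrArg (fun b => coeff b (m + 1 + d)) (coeff_equation h a)
  simp only [coeff_sub, coeff_add] at he
  have hnat : ∀ c : ℕ, (c : ℂ[X]).natDegree ≤ 0 := fun c => (natDegree_natCast c).le
  have t1 : ((X * dx G).coeff a).coeff (m + 1 + d) = 0 := by
    cases a with
    | zero => simp
    | succ a =>
      rw [coeff_X_mul, dx_coeff]
      apply coeff_eq_zero_of_natDegree_lt
      -- By maximality the degree rises from `G_a` to its lower neighbour by at most the slope,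
      -- hence by less than `m + 1`.
      have h1 := hmax' a (J + 1) (by omega)
      have h2 : (G.coeff a).natDegree < d + 1 + (m + 1) := by
        by_contra hcon
        have := Nat.mul_le_mul_right (J + 1) (not_lt.1 hcon)
        nlinarith
      have := natDegree_derivative_le (G.coeff a)
      omega
  have t2 : ((l + (a : ℂ[X]) * s) * G.coeff a).coeff (m + 1 + d) = 0 := by
    apply coeff_eq_zero_of_natDegree_lt
    have hle : (l + (a : ℂ[X]) * s).natDegree ≤ m - 1 :=
      natDegree_add_le_of_degree_le (by omega)
        ((natDegree_mul_le_of_le (hnat _) le_rfl).trans (by omega))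
    have := natDegree_mul_le_of_le hle hd.le
    omega
  have t3 : (((a : ℂ[X]) + 1) * r * G.coeff (a + 1)).coeff (m + 1 + d) = 0 := by
    apply coeff_eq_zero_of_natDegree_lt
    have hr' : (((a : ℂ[X]) + 1) * r).natDegree ≤ m := by
      refine (natDegree_mul_le_of_le (m := 0) ?_ hr).trans (by omega)
      exact_mod_cast hnat (a + 1)
    -- The slope is positive, so the degree drops strictly on passing to the upper neighbour.
    have h1 : (G.coeff (a + 1)).natDegree ≤ d := by
      cases J with
      | zero => rw [htop (a + 1) (by omega)]; omega
      | succ J =>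
        have := hmax' (a + 1) J (by omega)
        by_contra hcon
        have := Nat.mul_le_mul_right (J + 1 + 1) (Nat.succ_le_of_lt (not_le.1 hcon))
        rw [Nat.succ_eq_add_one] at this
        nlinarith
    have := natDegree_mul_le_of_le hr' h1
    omega
  have t4 : (p * derivative (G.coeff a)).coeff (m + 1 + d) =
      p.leadingCoeff * ((G.coeff a).leadingCoeff * (d + 1)) := by
    rw [coeff_mul_add_eq_of_natDegree_le hp.le
      ((natDegree_derivative_le _).trans (by omega)), coeff_derivative, leadingCoeff,
      leadingCoeff, hp, hd]
  rw [t1, t2, t3, t4] at he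
  have hp0 : p.leadingCoeff ≠ 0 := by
    rw [Ne, leadingCoeff_eq_zero]; rintro rfl; simp at hp
  have ha0 : (G.coeff a).leadingCoeff ≠ 0 := by
    rw [Ne, leadingCoeff_eq_zero]; intro h0; rw [h0] at hd; simp at hd
  have hd0 : (d : ℂ) + 1 ≠ 0 := by exact_mod_cast Nat.succ_ne_zero d
  exact mul_ne_zero hp0 (mul_ne_zero ha0 hd0) (by linear_combination he)

/-! ### Degree estimates for the polynomial `q`. -/

theorem coeff_q (f g : ℂ[X]) {l : ℕ} (hl : l ≤ f.natDegree) :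
    (q f g).coeff (f.natDegree + 1 - l) = qCoeff f g l := by
  rw [q, finsetSum_coeff, Finset.sum_eq_single_of_mem l (by simpa using by omega)]
  · simp
  · intro j hj hne
    rw [Finset.mem_range] at hj
    rw [coeff_C_mul_X_pow, if_neg (by omega)]

theorem natDegree_q_le (f g : ℂ[X]) : (q f g).natDegree ≤ f.natDegree + 1 :=
  natDegree_sum_le_of_forall_le _ _ fun l _ =>
    (natDegree_C_mul_X_pow_le _ _).trans (by omega)

theorem coeff_derivative_q (f g : ℂ[X]) {l : ℕ} (hl : l ≤ f.natDegree) :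
    (derivative (q f g)).coeff (f.natDegree - l) =
      qCoeff f g l * ((f.natDegree : ℂ) + 1 - l) := by
  rw [coeff_derivative, show f.natDegree - l + 1 = f.natDegree + 1 - l by omega, coeff_q f g hl,
    Nat.cast_sub hl]
  ring

theorem natDegree_derivative_q_le (f g : ℂ[X]) : (derivative (q f g)).natDegree ≤ f.natDegree :=
  (natDegree_derivative_le _).trans (Nat.sub_le_of_le_add (natDegree_q_le f g))

theorem qCoeff_zero (f g : ℂ[X]) :
    qCoeff f g 0 = -(f.leadingCoeff / ((f.natDegree : ℂ) + 1)) := by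
  rw [qCoeff]

theorem natDegree_q {f : ℂ[X]} (g : ℂ[X]) (hf : f ≠ 0) :
    (q f g).natDegree = f.natDegree + 1 := by
  refine natDegree_eq_of_le_of_coeff_ne_zero (natDegree_q_le f g) ?_
  have := coeff_q f g (Nat.zero_le f.natDegree)
  rw [Nat.sub_zero] at this
  rw [this, qCoeff_zero]
  exact neg_ne_zero.2 (div_ne_zero (leadingCoeff_ne_zero.2 hf) (Nat.cast_add_one_ne_zero _))

theorem natDegree_derivative_q_add_lt (f g : ℂ[X]) (hf : 0 < f.natDegree) :
    (derivative (q f g) + f).natDegree < f.natDegree := by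
  have hle : (derivative (q f g) + f).natDegree ≤ f.natDegree :=
    natDegree_add_le_of_degree_le (natDegree_derivative_q_le f g) le_rfl
  refine lt_of_le_of_ne hle fun heq => ?_
  have h0 : (derivative (q f g) + f).coeff f.natDegree = 0 := by
    have := coeff_derivative_q f g (Nat.zero_le f.natDegree)
    rw [Nat.sub_zero] at this
    have hm : (f.natDegree : ℂ) + 1 ≠ 0 := Nat.cast_add_one_ne_zero _
    rw [coeff_add, this, qCoeff_zero, coeff_natDegree]
    field_simp
    simp
  rw [← heq, coeff_natDegree, leadingCoeff_eq_zero] at h0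
  rw [h0, natDegree_zero] at heq
  omega

/-- Reflecting both factors turns coefficients counted from the top into an ordinary Cauchy product.
-/
theorem coeff_mul_sub {p r : ℂ[X]} {a b l : ℕ} (hp : p.natDegree ≤ a) (hr : r.natDegree ≤ b)
    (ha : l ≤ a) (hb : l ≤ b) :
    (p * r).coeff (a + b - l) =
      ∑ k ∈ Finset.range (l + 1), p.coeff (a - k) * r.coeff (b - (l - k)) := by
  have h := congrArg (fun p => coeff p l) (reflect_mul p r hp hr)
  simp only [coeff_reflect, coeff_mul (reflect a p)] at h
  rw [revAt_le (by omega)] at h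
  rw [h, Finset.Nat.sum_antidiagonal_eq_sum_range_succ
    (fun i j => p.coeff (revAt a i) * r.coeff (revAt b j))]
  refine Finset.sum_congr rfl fun k hk => ?_
  rw [Finset.mem_range] at hk
  rw [revAt_le (by omega), revAt_le (by omega)]

/-- The recursion for `q_l` says exactly that the coefficient of `x^(2m+1-l)` vanishes. -/
theorem natDegree_residue_le {f g : ℂ[X]} (hf : 0 < f.natDegree)
    (hgf : g.natDegree < 2 * f.natDegree + 1) :
    (q f g * derivative (q f g) + f * q f g + g).natDegree ≤ f.natDegree := by
  have hf0 : f.leadingCoeff ≠ 0 := by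
    rw [Ne, leadingCoeff_eq_zero]; rintro rfl; simp at hf
  have hm : (f.natDegree : ℂ) + 1 ≠ 0 := Nat.cast_add_one_ne_zero _
  have key : ∀ l ≤ f.natDegree,
      (q f g * derivative (q f g) + f * q f g + g).coeff (2 * f.natDegree + 1 - l) = 0 := by
    intro l hl
    rw [coeff_add, coeff_add, mul_comm (q f g) (derivative (q f g)), mul_comm f,
      show 2 * f.natDegree + 1 - l = f.natDegree + (f.natDegree + 1) - l by omega,
      coeff_mul_sub (natDegree_derivative_q_le f g) (natDegree_q_le f g) hl (by omega),
      show f.natDegree + (f.natDegree + 1) - l = f.natDegree + 1 + f.natDegree - l by omega,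
      coeff_mul_sub (natDegree_q_le f g) le_rfl (by omega) hl]
    have e1 : ∀ k ∈ Finset.range (l + 1), (derivative (q f g)).coeff (f.natDegree - k) *
        (q f g).coeff (f.natDegree + 1 - (l - k)) =
        ((f.natDegree : ℂ) + 1 - k) * qCoeff f g k * qCoeff f g (l - k) := by
      intro k hk
      rw [Finset.mem_range] at hk
      rw [coeff_derivative_q f g (by omega), coeff_q f g (by omega)]
      ring
    have e2 : ∀ k ∈ Finset.range (l + 1), (q f g).coeff (f.natDegree + 1 - k) *
        f.coeff (f.natDegree - (l - k)) = qCoeff f g k * f.coeff (f.natDegree - (l - k)) := by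
      intro k hk
      rw [Finset.mem_range] at hk
      rw [coeff_q f g (by omega)]
    rw [Finset.sum_congr rfl e1, Finset.sum_congr rfl e2]
    cases l with
    | zero =>
      rw [coeff_eq_zero_of_natDegree_lt (p := g) (by omega)]
      simp only [zero_add, Finset.sum_range_one, Nat.sub_zero, qCoeff_zero, coeff_natDegree]
      field_simp
      simp
    | succ l =>
      have hrec := qCoeff.eq_2 f g l
      rw [Fin.sum_univ_eq_sum_range
          (fun k => qCoeff f g k * f.coeff (f.natDegree - (l + 1 - k))) (l + 1),
        Fin.sum_univ_eq_sum_range (fun k => ((f.natDegree : ℂ) + 1 - ((k + 1 : ℕ) : ℂ)) *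
          qCoeff f g (k + 1) * qCoeff f g (l - k)) l] at hrec
      -- The terms containing `q_l` are split off: since `(m+1) q_0 = -f_0`, they add up to `(m+1-l)
      -- q_0 q_l`.
      rw [Finset.sum_range_succ, Finset.sum_range_succ',
        Finset.sum_range_succ (fun k => qCoeff f g k * f.coeff (f.natDegree - (l + 1 - k)))]
      simp only [Nat.add_sub_add_right, Nat.sub_self, Nat.sub_zero, coeff_natDegree, qCoeff_zero,
        Nat.cast_zero, sub_zero]
      rw [show 2 * f.natDegree + 1 - (l + 1) = f.natDegree + 1 + f.natDegree - (l + 1) by omega]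
        at hrec
      generalize (∑ k ∈ Finset.range l, ((f.natDegree : ℂ) + 1 - ((k + 1 : ℕ) : ℂ)) *
          qCoeff f g (k + 1) * qCoeff f g (l - k)) = S1 at *
      generalize (∑ k ∈ Finset.range (l + 1),
        qCoeff f g k * f.coeff (f.natDegree - (l + 1 - k))) = S2 at *
      have hml : (f.natDegree : ℂ) - ((l + 1 : ℕ) : ℂ) + 1 ≠ 0 := by
        rw [← Nat.cast_sub hl]; exact Nat.cast_add_one_ne_zero _
      generalize ((l + 1 : ℕ) : ℂ) = L at *
      generalize qCoeff f g (l + 1) = Q at *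
      field_simp at hrec ⊢
      linear_combination -hrec
  rw [natDegree_le_iff_coeff_eq_zero]
  intro i hi
  rcases Nat.lt_or_ge (2 * f.natDegree + 1) i with h | h
  · refine coeff_eq_zero_of_natDegree_lt (lt_of_le_of_lt ?_ h)
    refine natDegree_add_le_of_degree_le (natDegree_add_le_of_degree_le ?_ ?_) hgf.le
    · exact (natDegree_mul_le_of_le (natDegree_q_le f g) (natDegree_derivative_q_le f g)).trans
        (by omega)
    · exact (natDegree_mul_le_of_le le_rfl (natDegree_q_le f g)).trans (by omega)
  · have := key (2 * f.natDegree + 1 - i) (by omega)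
    rwa [show 2 * f.natDegree + 1 - (2 * f.natDegree + 1 - i) = i by omega] at this

/-! ### The shift by `q` and the conclusion. -/

/-- The invariance equation in the coordinates `x`, `w = y - p(x)`. -/
theorem shifted_equation {f g l : ℂ[X]} {F : ℂ[X][X]} (p : ℂ[X])
    (h : X * dx F + (-(C f * X) - C g) * dy F = C l * F) :
    (X + C p) * dx (F.comp (X + C p)) - (C (derivative p + f) * X +
      C (p * derivative p + f * p + g)) * dy (F.comp (X + C p)) = C l * F.comp (X + C p) := by
  have hchain := chain_rule (compRingHom (X + C p)) dx dx_add dx_mul (fun a => by simp [dx_C]) F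
  simp only [coe_compRingHom_apply, X_comp, dx_add, dx_X, dx_C, zero_add] at hchain
  have hdy : dy (F.comp (X + C p)) = (dy F).comp (X + C p) := by
    rw [dy, dy, derivative_comp]; simp
  have hc := congrArg (fun P => P.comp (X + C p)) h
  simp only [add_comp, mul_comp, sub_comp, neg_comp, X_comp, C_comp] at hc
  rw [hchain, hdy]
  simp only [C_add, C_mul]
  linear_combination hc

/-- An irreducible polynomial in `x`, `y` whose coefficients do not depend on `x` is linear. -/
theorem eq_linear_of_natDegree_coeff_eq_zero {G : ℂ[X][X]} (hG : Irreducible G)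
    (hcoeff : ∀ k, (G.coeff k).natDegree = 0) (hdeg : G.natDegree ≠ 0) :
    ∃ c z : ℂ, c ≠ 0 ∧ G = C (C c) * (X - C (C z)) := by
  obtain ⟨P, rfl⟩ : ∃ P : ℂ[X], P.map C = G := by
    rw [← mem_lifts, lifts_iff_coeff_lifts]
    exact fun k => ⟨(G.coeff k).coeff 0, (eq_C_of_natDegree_eq_zero (hcoeff k)).symm⟩
  have hinj : Function.Injective (C : ℂ →+* ℂ[X]) := C_injective
  rw [natDegree_map_eq_of_injective hinj] at hdeg
  obtain ⟨z, hz⟩ := Complex.exists_root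
    (natDegree_pos_iff_degree_pos.1 (Nat.pos_of_ne_zero hdeg))
  obtain ⟨Q, rfl⟩ := dvd_iff_isRoot.2 hz
  have hX : ¬ IsUnit ((X - C z : ℂ[X]).map C) := by
    rw [Polynomial.map_sub, map_X, map_C]
    exact not_isUnit_X_sub_C _
  rw [Polynomial.map_mul] at hG ⊢
  have hQ := (hG.isUnit_or_isUnit rfl).resolve_left hX
  obtain ⟨c, hc, hcQ⟩ := Polynomial.isUnit_iff.1 hQ
  obtain ⟨c', hc', rfl⟩ := Polynomial.isUnit_iff.1 hc
  refine ⟨c', z, hc'.ne_zero, ?_⟩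
  rw [← hcQ, mul_comm]
  simp

end Lienard

end

theorem lemma3 (f g : Polynomial ℂ)
    (hfg : f.natDegree < g.natDegree) (hgf : g.natDegree < 2 * f.natDegree + 1)
    (F : Polynomial (Polynomial ℂ)) (hirr : Irreducible F)
    (hinv : Lienard.IsLienardCurve f g F)
    (hII : ∀ y : LaurentSeries ℂ, Lienard.IsTypeII f g y → ¬ Lienard.Captures F y) :
    F.natDegree = 1 ∧
      ∃ c z₀ : ℂ, c ≠ 0 ∧
        F = Polynomial.C (Polynomial.C c) *
          (Polynomial.X - Polynomial.C (Lienard.q f g) -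
            Polynomial.C (Polynomial.C z₀)) := by
  have hf : 0 < f.natDegree := by omega
  have hf0 : f ≠ 0 := by rintro rfl; simp at hf
  obtain ⟨hnc, lam, h⟩ := hinv
  obtain ⟨⟨l, rfl⟩, μ, hμ⟩ := Lienard.cofactor_eq_C hirr.ne_zero h
  have hdeg : F.natDegree ≠ 0 := by
    intro h0
    refine hnc μ ?_
    rw [← hμ, leadingCoeff, h0]
    exact eq_C_of_natDegree_eq_zero h0
  obtain ⟨y, hy⟩ := Lienard.exists_isTypeII f g hfg hgf
  have hl := Lienard.natDegree_cofactor_lt hfg hgf h hy (hII y hy)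
  set p := Lienard.q f g with hp
  have hcomp : (F.comp (X + C p)).leadingCoeff.natDegree = 0 := by
    rw [leadingCoeff_comp (by rw [natDegree_X_add_C]; exact one_ne_zero), leadingCoeff_X_add_C,
      one_pow, mul_one, hμ, natDegree_C]
  have hcoeff := Lienard.natDegree_coeff_eq_zero (Lienard.natDegree_q g hf0)
    (Lienard.natDegree_residue_le hf hgf) (Lienard.natDegree_derivative_q_add_lt f g hf) hl
    hcomp (Lienard.shifted_equation p h)
  -- The shift `y ↦ y + p` is an automorphism of `ℂ[x][y]`.
  have hG : Irreducible (F.comp (X + C p)) :=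
    (MulEquiv.irreducible_iff (algEquivAevalXAddC p)).2 hirr
  obtain ⟨c, z, hc, hGe⟩ := Lienard.eq_linear_of_natDegree_coeff_eq_zero hG hcoeff (by
    rw [natDegree_comp, natDegree_X_add_C, mul_one]; exact hdeg)
  have hFe : F = C (C c) * (X - C p - C (C z)) := by
    have := congrArg (fun P => P.comp (X - C p)) hGe
    simpa [comp_assoc] using this
  refine ⟨?_, c, z, hc, hFe⟩
  rw [hFe, natDegree_C_mul (by simpa using hc), sub_sub, ← C_add, natDegree_X_sub_C]
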